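/- All sets are finite and all Hilbert spaces are finite-dimensional and complex. For a Hilbert space $\mathcal{H}$, let $\mathsf{L}(\mathcal{H})$ be the set of linear operators on $\mathcal{H}$ and $\mathsf{S}(\mathcal{H})$ the set of density matrices on $\mathcal{H}$ (operators $\rho\ge 0$ with $\operatorname{Tr}\rho=1$). For a bipartite state $\rho_{AB}$, the conditional min-entropy is \[ H_{\min}(A|B)_\rho=\sup\bigl\{\lambda\in\mathbb{R}:\ \rho_{AB}\le 2^{-\lambda}\,\mathbb{1}_A\otimes\tau_B\ \text{for some}\ \tau_B\in\mathsf{S}(\mathcal{H}_B)\bigr\}. \] Given a pair $(\rho_0,\rho_1)$ of states in $\mathsf{S}(\mathcal{H}_Q)$, a set $U$ and a joint probability distribution $p$ on $U\times\{0,1\}$, put \[ \rho_{UQ}=\sum_{u\in U}\sum_{x\in\{0,1\}}p(u,x)\,|u\rangle\langle u|_U\otimes\rho_x , \] where $\{|u\rangle\}_{u\in U}$ is an orthonormal basis of an auxiliary space $\mathcal{H}_U$; for a pair $(\sigma_0,\sigma_1)$ in $\mathsf{S}(\mathcal{H}_{Q'})$ define $\sigma_{UQ'}$ in the same way. Write $(\rho_0,\rho_1)\succeq(\sigma_0,\sigma_1)$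 if \[ H_{\min}(U|Q)_\rho\le H_{\min}(U|Q')_\sigma \] for every set $U$ and every joint probability distribution $p$ on $U\times\{0,1\}$. **Lemma.** Let $(\rho_0,\rho_1)$ and $(\sigma_0,\sigma_1)$ be two pairs of density matrices in $\mathsf{S}(\mathcal{H}_Q)$ and $\mathsf{S}(\mathcal{H}_{Q'})$, respectively, and assume that $[\sigma_0,\sigma_1]=0$. Then $(\rho_0,\rho_1)\succeq(\sigma_0,\sigma_1)$ if and only if there exists a completely positive trace-preserving linear map $\Phi:\mathsf{L}(\mathcal{H}_Q)\to\mathsf{L}(\mathcal{H}_{Q'})$ such that $\Phi(\rho_i)=\sigma_i$ for $i=0,1$. Moreover, the comparison can be restricted to sets $U$ with $|U|=\dim\mathcal{H}_{Q'}$: $(\rho_0,\rho_1)\succeq(\sigma_0,\sigma_1)$ holds if and only if the inequality $H_{\min}(U|Q)_\rho\le H_{\min}(U|Q')_\sigma$ holds for every set $U$ with $|U|=\dim\mathcal{H}_{Q'}$ and every joint probability distribution $p$ on $U\times\{0,1\}$. -/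

import Mathlib

open scoped MatrixOrder ComplexOrder Kronecker

/-- `IsDensity ρ`: the matrix `ρ` is a density matrix (a state), i.e. `ρ ≥ 0` and `Tr ρ = 1`. The
finite type `ι` labels an orthonormal basis of the Hilbert space, so the dimension of that space is
`Fintype.card ι`. -/
def IsDensity {ι : Type*} [Fintype ι] (ρ : Matrix ι ι ℂ) : Prop :=
  0 ≤ ρ ∧ ρ.trace = 1

/-- The conditional min-entropy `H_min(A|B)_ρ` of a bipartite state `ρ` on the tensor product of
the systems `A` and `B`: the supremum of all real `r` such that `ρ ≤ 2 ^ (-r) • (1_A ⊗ τ_B)` for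
some density matrix `τ_B` of the system `B`. -/
noncomputable def condMinEntropy {A B : Type*} [Fintype A] [DecidableEq A] [Fintype B]
    (ρ : Matrix (A × B) (A × B) ℂ) : ℝ :=
  sSup {r : ℝ | ∃ τ : Matrix B B ℂ, IsDensity τ ∧
    ρ ≤ (2 : ℝ) ^ (-r) • ((1 : Matrix A A ℂ) ⊗ₖ τ)}

/-- The classical-quantum state `∑ u, ∑ x, p(u, x) |u⟩⟨u| ⊗ ρ x` that arises when the second
component of a random pair with joint distribution `p` is encoded in the states `ρ 0`, `ρ 1`. -/
noncomputable def cqState {U Q : Type*} [Fintype U] [DecidableEq U]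
    (p : U × Fin 2 → ℝ) (ρ : Fin 2 → Matrix Q Q ℂ) : Matrix (U × Q) (U × Q) ℂ :=
  ∑ u : U, ∑ x : Fin 2, p (u, x) • (Matrix.single u u (1 : ℂ) ⊗ₖ ρ x)

/-- The inequality `H_min(U|Q)_ρ ≤ H_min(U|Q')_σ` for all joint probability distributions
on `U × {0, 1}`, where the set `U` is fixed. -/
def MoreInformativeOn (U : Type) [Fintype U] [DecidableEq U] {Q Q' : Type*} [Fintype Q]
    [Fintype Q'] (ρ : Fin 2 → Matrix Q Q ℂ) (σ : Fin 2 → Matrix Q' Q' ℂ) : Prop :=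
  ∀ p ∈ stdSimplex ℝ (U × Fin 2),
    condMinEntropy (cqState p ρ) ≤ condMinEntropy (cqState p σ)

/-- The information ordering `(ρ 0, ρ 1) ⪰ (σ 0, σ 1)`: the inequality
`H_min(U|Q)_ρ ≤ H_min(U|Q')_σ` holds for all finite sets `U` and all joint probability
distributions on `U × {0, 1}`. -/
def MoreInformative {Q Q' : Type*} [Fintype Q] [Fintype Q']
    (ρ : Fin 2 → Matrix Q Q ℂ) (σ : Fin 2 → Matrix Q' Q' ℂ) : Prop :=
  ∀ (U : Type) [Fintype U] [DecidableEq U], MoreInformativeOn U ρ σ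

section Channel

open scoped Matrix.Norms.L2Operator CStarAlgebra

/-- `IsCPTP Φ`: the linear map `Φ` is completely positive and trace preserving, i.e. it is a
quantum channel. -/
def IsCPTP {Q Q' : Type*} [Fintype Q] [DecidableEq Q] [Fintype Q'] [DecidableEq Q']
    (Φ : Matrix Q Q ℂ →ₗ[ℂ] Matrix Q' Q' ℂ) : Prop :=
  (∃ Ψ : Matrix Q Q ℂ →CP Matrix Q' Q' ℂ, Ψ.toLinearMap = Φ) ∧
    ∀ X : Matrix Q Q ℂ, (Φ X).trace = X.trace

end Channel

/-!
The order `⪰` compares how well the random variable `U` can be guessed: `condMinEntropy` is minus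
the binary logarithm of the least trace of a `τ` dominating all operators `∑ x, p (u, x) • ρ x`.

A channel maps dominating operators to dominating operators, which gives the data-processing
direction (`IsCPTP.moreInformative`).

For the converse, the commuting states `σ 0`, `σ 1` are diagonal in a common orthonormal basis,
with diagonals `s 0`, `s 1`. A channel from `ρ` to `σ` exists as soon as some measurement `M` on the
space of `ρ` satisfies `Tr (M k * ρ i) = s i k`: measure `M`, then prepare the basis vector given by
the outcome (`measurePrepare`). The measurements are indexed by a basis of the space of `σ`, which
is why sets `U` of that size suffice. If no such measurement exists, then the Hahn-Banach theorem,
applied to the compact convex image of the tuples of positive matrices of fixed total trace, yields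
coefficients `c k i` and a matrix `τ` such that `∑ i, c k i • ρ i ≤ τ` for all `k` while
`Tr τ < ∑ k i, c k i * s i k` (`exists_measurement_or_dual_certificate`). The separation thus
provides the dual solution directly, and no strong duality for the entropy is needed. After a shift
and a normalization `c` is a probability distribution, `τ` bounds the entropy for `ρ` from below,
and measuring in the common eigenbasis bounds the entropy for `σ` from above
(`sum_le_of_cqState_le`), so that the distribution violates the ordering
(`not_moreInformativeOn_of_dual_certificate`).
-/

open Matrix

/-! ### The Löwner order on matrices -/

/-- A positive semidefinite matrix is bounded by its trace times the identity. -/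
lemma Matrix.PosSemidef.le_trace_smul_one {n : Type*} [Fintype n] [DecidableEq n]
    {M : Matrix n n ℂ} (hM : M.PosSemidef) : M ≤ M.trace.re • (1 : Matrix n n ℂ) := by
  rw [← Algebra.algebraMap_eq_smul_one]
  refine le_algebraMap_of_spectrum_le ?_ hM.isHermitian
  intro x hx
  rw [hM.isHermitian.spectrum_real_eq_range_eigenvalues] at hx
  obtain ⟨i, rfl⟩ := hx
  have : M.trace.re = ∑ j, hM.isHermitian.eigenvalues j := by
    rw [hM.isHermitian.trace_eq_sum_eigenvalues]
    simp
  rw [this]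
  exact Finset.single_le_sum (fun j _ => hM.eigenvalues_nonneg j) (Finset.mem_univ i)

/-- Conjugation by a rectangular matrix is monotone for the Löwner order. -/
lemma Matrix.mul_mul_conjTranspose_mono {m n : Type*} [Fintype m] [Fintype n]
    {A B : Matrix n n ℂ} (h : A ≤ B) (C : Matrix m n ℂ) : C * A * Cᴴ ≤ C * B * Cᴴ := by
  rw [Matrix.le_iff] at h ⊢
  have := h.mul_mul_conjTranspose_same C
  rwa [Matrix.mul_sub, Matrix.sub_mul] at this

/-- The trace of a product of two Hermitian matrices is real. -/
lemma Matrix.IsHermitian.trace_mul_im {n : Type*} [Fintype n] {A B : Matrix n n ℂ}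
    (hA : A.IsHermitian) (hB : B.IsHermitian) : (A * B).trace.im = 0 := by
  have h : star (A * B).trace = (A * B).trace := by
    rw [← trace_conjTranspose, conjTranspose_mul, hA.eq, hB.eq, trace_mul_comm]
  exact Complex.conj_eq_iff_im.mp h

lemma Matrix.trace_re_mono {n : Type*} [Fintype n] {A B : Matrix n n ℂ} (h : A ≤ B) :
    A.trace.re ≤ B.trace.re := by
  have := (Matrix.le_iff.mp h).trace_nonneg
  rw [trace_sub, Complex.le_def] at this
  simpa using this.1

/-! ### Common eigenbases of commuting Hermitian matrices -/

open LinearMap Module.End in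
/-- Two commuting Hermitian matrices are diagonalized by a common unitary, with real
diagonal entries. The diagonal form is
indexed by `Fin (Fintype.card n)` so that the index type lies in `Type`. -/
theorem Matrix.IsHermitian.exists_simultaneous_diagonalization {n : Type*} [Fintype n]
    [DecidableEq n] {A : Fin 2 → Matrix n n ℂ} (hA : ∀ i, (A i).IsHermitian)
    (hcomm : Commute (A 0) (A 1)) :
    ∃ (W : Matrix n (Fin (Fintype.card n)) ℂ) (a : Fin 2 → Fin (Fintype.card n) → ℝ),
      Wᴴ * W = 1 ∧ W * Wᴴ = 1 ∧ ∀ i, A i = W * diagonal (fun k => (a i k : ℂ)) * Wᴴ := by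
  classical
  have hsym : ∀ i, (toEuclideanLin (A i)).IsSymmetric := fun i =>
    isSymmetric_toEuclideanLin_iff.mpr (hA i)
  have hc : Pairwise (Function.onFun Commute fun i => toEuclideanLin (A i)) := by
    have h01 : Commute (toEuclideanLin (A 0)) (toEuclideanLin (A 1)) := by
      rw [Commute, SemiconjBy]
      ext x : 1
      simp [toLpLin_apply, Matrix.mulVec_mulVec, hcomm.eq]
    intro i j hij
    fin_cases i <;> fin_cases j
    · exact absurd rfl hij
    · exact h01
    · exact h01.symm
    · exact absurd rfl hij
  let V : (Fin 2 → ℂ) → Submodule ℂ (EuclideanSpace ℂ n) :=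
    fun α => ⨅ j, eigenspace (toEuclideanLin (A j)) (α j)
  have hVint : DirectSum.IsInternal V :=
    IsSymmetric.directSum_isInternal_of_pairwise_commute hsym hc
  have hVorth := IsSymmetric.orthogonalFamily_iInf_eigenspaces hsym
  -- Only finitely many joint eigenspaces are nonzero.
  have hfin : Finite {α // V α ≠ ⊥} :=
    WellFoundedGT.finite_ne_bot_of_iSupIndep hVint.submodule_iSupIndep
  have := Fintype.ofFinite {α // V α ≠ ⊥}
  have hV : DirectSum.IsInternal fun α : {α // V α ≠ ⊥} => V α :=
    DirectSum.isInternal_ne_bot_iff.mpr hVint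
  have hV' : OrthogonalFamily ℂ (fun α : {α // V α ≠ ⊥} => V α)
      fun α => (V α).subtypeₗᵢ := hVorth.comp Subtype.val_injective
  have hn : Module.finrank ℂ (EuclideanSpace ℂ n) = Fintype.card n := finrank_euclideanSpace
  let b := hV.subordinateOrthonormalBasis hn hV'
  let a : Fin (Fintype.card n) → Fin 2 → ℂ := fun k =>
    hV.subordinateOrthonormalBasisIndex hn k hV' |>.1
  have hb : ∀ i k, (A i) *ᵥ (b k) = a k i • (b k : n → ℂ) := by
    intro i k
    have := hV.subordinateOrthonormalBasis_subordinate hn k hV'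
    have := mem_eigenspace_iff.mp ((Submodule.mem_iInf _).mp this i)
    have := congrArg (WithLp.ofLp) this
    simpa [toLpLin_apply] using this
  let W : Matrix n (Fin (Fintype.card n)) ℂ := Matrix.of fun x k => b k x
  have hW : Wᴴ * W = 1 := by
    ext k l
    have := orthonormal_iff_ite.mp b.orthonormal k l
    rw [Matrix.one_apply, ← this, Matrix.mul_apply, PiLp.inner_apply]
    simp [W, mul_comm]
  have hW' : W * Wᴴ = 1 := (mul_eq_one_comm_of_card_eq _ _ _ (by simp)).mp hW
  refine ⟨W, fun i k => (a k i).re, hW, hW', fun i => ?_⟩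
  have hAW : A i * W = W * diagonal (fun k => a k i) := by
    ext x k
    have := congrFun (hb i k) x
    rw [Matrix.mul_diagonal]
    simpa [W, Matrix.mul_apply, Matrix.mulVec, dotProduct, mul_comm] using this
  have hdiag : diagonal (fun k => a k i) = Wᴴ * A i * W := by
    rw [Matrix.mul_assoc, hAW, ← Matrix.mul_assoc, hW, Matrix.one_mul]
  have hreal : (fun k => ((a k i).re : ℂ)) = fun k => a k i := by
    have hherm : (diagonal fun k => a k i).IsHermitian :=
      hdiag ▸ isHermitian_conjTranspose_mul_mul W (hA i)
    ext k
    simpa using hherm.coe_re_apply_self k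
  rw [hreal, ← hAW, Matrix.mul_assoc, hW', Matrix.mul_one]

/-! ### Kraus maps -/

section
open scoped Matrix.Norms.L2Operator CStarAlgebra

/-- Stated for an abstract algebra because the continuous functional calculus instances that it
needs are not found by unification on `CStarMatrix`. -/
lemma CStarAlgebra.exists_eq_star_mul_self {A : Type*} [NonUnitalCStarAlgebra A]
    [PartialOrder A] [StarOrderedRing A] {a : A} (ha : 0 ≤ a) : ∃ b, a = star b * b :=
  CStarAlgebra.nonneg_iff_eq_star_mul_self.mp ha

lemma CStarMatrix.finset_sum_apply {α m n A : Type*} [AddCommMonoid A]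
    (t : Finset α) (F : α → CStarMatrix m n A) (i : m) (j : n) :
    (∑ a ∈ t, F a) i j = ∑ a ∈ t, F a i j :=
  Matrix.sum_apply i j t fun a => CStarMatrix.ofMatrix.symm (F a)

/-- A linear map in Kraus form is completely positive. Writing a positive block matrix as `Bᴴ B`,
its image is the sum of the matrices `Cᴴ C`, where `C` runs through the rows of the blocks
`B i j * (K a)ᴴ`; a row is made into a square block by placing it in a fixed row `x₀`. -/
theorem exists_completelyPositiveMap_of_kraus {Q Q' α : Type*} [Fintype Q] [DecidableEq Q]
    [Fintype Q'] [DecidableEq Q'] [Fintype α] (K : α → Matrix Q' Q ℂ)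
    (Φ : Matrix Q Q ℂ →ₗ[ℂ] Matrix Q' Q' ℂ) (hΦ : ∀ X, Φ X = ∑ a, K a * X * (K a)ᴴ) :
    ∃ Ψ : Matrix Q Q ℂ →CP Matrix Q' Q' ℂ, Ψ.toLinearMap = Φ := by
  refine ⟨⟨Φ, fun k M hM => ?_⟩, rfl⟩
  rcases isEmpty_or_nonempty Q' with hQ' | ⟨⟨x₀⟩⟩
  · exact le_of_eq (Subsingleton.elim _ _)
  obtain ⟨B, rfl⟩ := CStarAlgebra.exists_eq_star_mul_self hM
  let C : α → Q → CStarMatrix (Fin k) (Fin k) (Matrix Q' Q' ℂ) := fun a q =>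
    CStarMatrix.ofMatrix fun l j => Matrix.of fun x y =>
      if x = x₀ then (B l j * (K a)ᴴ) q y else 0
  have hCe : ∀ a q l j x y, C a q l j x y = if x = x₀ then (B l j * (K a)ᴴ) q y else 0 :=
    fun _ _ _ _ _ _ => rfl
  have key : (star B * B).map Φ = ∑ a, ∑ q, star (C a q) * C a q := by
    ext i j x y
    have hC : ∀ a q, (star (C a q) * C a q) i j x y =
        ∑ l, star ((B l i * (K a)ᴴ) q x) * (B l j * (K a)ᴴ) q y := by
      intro a q
      simp only [CStarMatrix.mul_apply, CStarMatrix.star_apply, Matrix.sum_apply,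
        Matrix.mul_apply (M := star _), Matrix.star_apply]
      refine Finset.sum_congr rfl fun l _ => ?_
      simp [hCe, apply_ite]
    have hl : ((star B * B).map Φ) i j x y =
        ∑ a, ∑ l, (((B l i) * (K a)ᴴ)ᴴ * (B l j * (K a)ᴴ)) x y := by
      rw [CStarMatrix.map_apply, hΦ, CStarMatrix.mul_apply, Matrix.sum_apply]
      refine Finset.sum_congr rfl fun a _ => ?_
      rw [Matrix.mul_sum, Matrix.sum_mul, Matrix.sum_apply]
      refine Finset.sum_congr rfl fun l _ => ?_
      rw [conjTranspose_mul, conjTranspose_conjTranspose, CStarMatrix.star_apply]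
      simp only [Matrix.mul_assoc, Matrix.star_eq_conjTranspose]
    have hr : (∑ a, ∑ q, star (C a q) * C a q) i j x y =
        ∑ a, ∑ q, (star (C a q) * C a q) i j x y := by
      simp only [CStarMatrix.finset_sum_apply, Matrix.sum_apply]
    rw [hl, hr]
    refine Finset.sum_congr rfl fun a _ => ?_
    simp only [hC]
    rw [Finset.sum_comm]
    rfl
  change 0 ≤ (star B * B).map Φ
  rw [key]
  exact Finset.sum_nonneg fun a _ => Finset.sum_nonneg fun q _ => star_mul_self_nonneg _

/-- A channel maps positive matrices to positive matrices. -/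
lemma IsCPTP.monotone {Q Q' : Type*} [Fintype Q] [DecidableEq Q]
    [Fintype Q'] [DecidableEq Q'] {Φ : Matrix Q Q ℂ →ₗ[ℂ] Matrix Q' Q' ℂ} (hΦ : IsCPTP Φ) :
    Monotone Φ := by
  obtain ⟨⟨Ψ, rfl⟩, -⟩ := hΦ
  exact OrderHomClass.mono Ψ

end

/-! ### Measure-and-prepare channels -/

/-- The measure-and-prepare map `X ↦ ∑ k, Tr (M k X) |w k⟩⟨w k|` for a measurement `M` and an
isometry `W` with columns `w k`. -/
noncomputable def measurePrepare {Q Q' κ : Type*} [Fintype Q] [Fintype κ] [DecidableEq κ]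
    (M : κ → Matrix Q Q ℂ) (W : Matrix Q' κ ℂ) : Matrix Q Q ℂ →ₗ[ℂ] Matrix Q' Q' ℂ where
  toFun X := W * diagonal (fun k => (M k * X).trace) * Wᴴ
  map_add' X Y := by
    rw [← Matrix.add_mul, ← Matrix.mul_add, diagonal_add]
    simp [Matrix.mul_add]
  map_smul' c X := by
    rw [RingHom.id_apply, ← Matrix.smul_mul, ← Matrix.mul_smul, ← diagonal_smul]
    congr
    ext k
    simp

lemma measurePrepare_apply {Q Q' κ : Type*} [Fintype Q] [Fintype κ] [DecidableEq κ]
    (M : κ → Matrix Q Q ℂ) (W : Matrix Q' κ ℂ) (X : Matrix Q Q ℂ) :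
    measurePrepare M W X = W * diagonal (fun k => (M k * X).trace) * Wᴴ :=
  rfl

theorem isCPTP_measurePrepare {Q Q' κ : Type*} [Fintype Q] [DecidableEq Q] [Fintype Q']
    [DecidableEq Q'] [Fintype κ] [DecidableEq κ] {M : κ → Matrix Q Q ℂ} {W : Matrix Q' κ ℂ}
    (hM : ∀ k, 0 ≤ M k) (hsum : ∑ k, M k = 1) (hW : Wᴴ * W = 1) :
    IsCPTP (measurePrepare M W) := by
  constructor
  · choose N hN using fun k => CStarAlgebra.nonneg_iff_eq_star_mul_self.mp (hM k)
    -- The Kraus operators are `|w k⟩⟨n k q|`, where `n k q` is row `q` of a square root of `M k`.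
    refine exists_completelyPositiveMap_of_kraus
      (fun a : κ × Q => vecMulVec (fun x => W x a.1) (N a.1 a.2)) _ fun X => ?_
    have htr : ∀ k, (M k * X).trace = ∑ q, N k q ⬝ᵥ X *ᵥ star (N k q) := by
      intro k
      rw [hN k, star_eq_conjTranspose, Matrix.mul_assoc, trace_mul_comm]
      simp [Matrix.trace, Matrix.mul_apply, Matrix.mulVec, dotProduct, Finset.mul_sum,
        mul_assoc]
    ext x y
    have hentry : ∀ k q, (vecMulVec (fun x => W x k) (N k q) * X *
        (vecMulVec (fun x => W x k) (N k q))ᴴ) x y =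
          W x k * (N k q ⬝ᵥ X *ᵥ star (N k q)) * star (W y k) := by
      intro k q
      rw [conjTranspose_vecMulVec, vecMulVec_mul, vecMulVec_mul_vecMulVec, dotProduct_mulVec]
      simp [vecMulVec_apply, mul_assoc]
    rw [measurePrepare_apply, Matrix.mul_apply, Matrix.sum_apply, Fintype.sum_prod_type]
    refine Finset.sum_congr rfl fun k _ => ?_
    simp only [hentry, Matrix.mul_diagonal, conjTranspose_apply, htr, Finset.mul_sum,
      Finset.sum_mul]
  · intro X
    rw [measurePrepare_apply, Matrix.mul_assoc, trace_mul_comm, Matrix.mul_assoc, hW, Matrix.mul_one, trace_diagonal,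
      ← trace_sum, ← Matrix.sum_mul, hsum, Matrix.one_mul]

/-! ### Existence of measurements by separation -/

section
open scoped Matrix.Norms.L2Operator

/-- The tuples of positive semidefinite matrices with a prescribed total trace form a compact
set. -/
lemma isCompact_posSemidef_trace_eq (κ Q : Type*) [Fintype κ] [Fintype Q] [DecidableEq Q] (d : ℝ) :
    IsCompact {M : κ → Matrix Q Q ℂ | (∀ k, 0 ≤ M k) ∧ ∑ k, (M k).trace = d} := by
  have : ProperSpace (κ → Matrix Q Q ℂ) := FiniteDimensional.proper ℂ _
  refine Metric.isCompact_of_isClosed_isBounded ?_ ?_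
  · refine IsClosed.inter ?_ ?_
    · have : {M : κ → Matrix Q Q ℂ | ∀ k, 0 ≤ M k} = ⋂ k, (fun M => M k) ⁻¹' {X | 0 ≤ X} := by
        ext; simp
      change IsClosed {M : κ → Matrix Q Q ℂ | ∀ k, 0 ≤ M k}
      rw [this]
      exact isClosed_iInter fun k =>
        CStarAlgebra.isClosed_nonneg.preimage (continuous_apply k)
    · refine isClosed_eq ?_ continuous_const
      fun_prop
  · refine isBounded_iff_forall_norm_le.mpr ⟨d, fun M hM => ?_⟩
    have hd : ∑ k, (M k).trace.re = d := by simpa using congrArg Complex.re hM.2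
    have h0 : ∀ k, 0 ≤ (M k).trace.re := fun k =>
      (Complex.le_def.mp (nonneg_iff_posSemidef.mp (hM.1 k)).trace_nonneg).1
    have hd0 : 0 ≤ d := hd ▸ Finset.sum_nonneg fun k _ => h0 k
    refine (pi_norm_le_iff_of_nonneg hd0).mpr fun k => ?_
    calc ‖M k‖ ≤ (M k).trace.re := by
          rw [CStarAlgebra.norm_le_iff_le_algebraMap _ (h0 k) (hM.1 k),
            Algebra.algebraMap_eq_smul_one]
          exact (nonneg_iff_posSemidef.mp (hM.1 k)).le_trace_smul_one
      _ ≤ d := hd ▸ Finset.single_le_sum (fun j _ => h0 j) (Finset.mem_univ k)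

/-- A complex linear functional on pairs of a matrix and an array of numbers is given by the
trace pairing with a matrix and the sum pairing with an array. -/
lemma exists_trace_pairing {κ ι Q : Type*} [Fintype κ] [Fintype ι] [Fintype Q] [DecidableEq κ]
    [DecidableEq ι] [DecidableEq Q] (f : Matrix Q Q ℂ × (κ → ι → ℂ) →ₗ[ℂ] ℂ) :
    ∃ (T : Matrix Q Q ℂ) (c : κ → ι → ℂ),
      ∀ X z, f (X, z) = (T * X).trace + ∑ k, ∑ i, c k i * z k i := by
  refine ⟨Matrix.of fun j i => f (Matrix.single i j 1, 0),
    fun k i => f (0, Pi.single k (Pi.single i 1)), fun X z => ?_⟩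
  have hsplit : ((X, z) : Matrix Q Q ℂ × (κ → ι → ℂ)) =
      (∑ i, ∑ j, X i j • ((Matrix.single i j 1, 0) : Matrix Q Q ℂ × (κ → ι → ℂ))) +
        ∑ k, ∑ i, z k i • ((0, Pi.single k (Pi.single i 1)) : Matrix Q Q ℂ × (κ → ι → ℂ)) := by
    ext1
    · simp only [Prod.fst_add, Prod.fst_sum, Prod.smul_fst, smul_zero, Finset.sum_const_zero,
        add_zero, smul_single, smul_eq_mul, mul_one]
      exact matrix_eq_sum_single X
    · ext k i
      simp [Prod.snd_sum, Finset.sum_apply, Pi.single_apply, apply_ite]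
  rw [hsplit]
  simp only [map_add, map_sum, map_smul, smul_eq_mul, Matrix.trace, Matrix.diag, Matrix.mul_apply,
    Matrix.of_apply]
  rw [Finset.sum_comm]
  simp only [mul_comm]

/-- Farkas alternative for measurements: either some measurement `M` has the prescribed outcome
statistics `Tr (M k * ρ i) = s k i`, or some array `c` of coefficients together with a dual feasible
matrix `τ` certifies that no measurement does. -/
theorem exists_measurement_or_dual_certificate {κ ι Q : Type*} [Fintype κ] [Fintype ι] [Fintype Q]
    [DecidableEq Q] [Nonempty Q] {ρ : ι → Matrix Q Q ℂ} (hρ : ∀ i, (ρ i).IsHermitian)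
    (s : κ → ι → ℝ) :
    (∃ M : κ → Matrix Q Q ℂ, (∀ k, 0 ≤ M k) ∧ ∑ k, M k = 1 ∧
      ∀ k i, (M k * ρ i).trace = s k i) ∨
    ∃ (c : κ → ι → ℝ) (τ : Matrix Q Q ℂ), (∀ k, ∑ i, c k i • ρ i ≤ τ) ∧
      τ.trace.re < ∑ k, ∑ i, c k i * s k i := by
  classical
  let d : ℝ := Fintype.card Q
  have hd : 0 < d := Nat.cast_pos.mpr Fintype.card_pos
  let S : Set (κ → Matrix Q Q ℂ) := {M | (∀ k, 0 ≤ M k) ∧ ∑ k, (M k).trace = d}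
  let L : (κ → Matrix Q Q ℂ) →ₗ[ℂ] Matrix Q Q ℂ × (κ → ι → ℂ) :=
    { toFun := fun M => (∑ k, M k, fun k i => (M k * ρ i).trace)
      map_add' := fun M N => by
        ext1
        · simp [Finset.sum_add_distrib]
        · ext k i; simp [Matrix.add_mul]
      map_smul' := fun a M => by
        ext1
        · simp [Finset.smul_sum]
        · ext k i; simp }
  let b : Matrix Q Q ℂ × (κ → ι → ℂ) := (1, fun k i => s k i)
  by_cases hb : b ∈ L '' S
  · obtain ⟨M, hM, hMb⟩ := hb
    refine .inl ⟨M, hM.1, congrArg Prod.fst hMb, fun k i => ?_⟩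
    exact congrFun (congrFun (congrArg Prod.snd hMb) k) i
  right
  have hSc : IsCompact (L '' S) :=
    (isCompact_posSemidef_trace_eq κ Q d).image L.continuous_of_finiteDimensional
  have hSconv : Convex ℝ S := by
    intro M hM N hN x y hx hy hxy
    refine ⟨fun k => add_nonneg (smul_nonneg hx (hM.1 k)) (smul_nonneg hy (hN.1 k)), ?_⟩
    simp only [Pi.add_apply, Pi.smul_apply, trace_add, trace_smul, Finset.sum_add_distrib,
      ← Finset.smul_sum, hM.2, hN.2, ← add_smul, hxy, one_smul]
  have hSconv' : Convex ℝ (L '' S) := hSconv.linear_image (L.restrictScalars ℝ)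
  obtain ⟨f, u, hfu, huf⟩ :=
    RCLike.geometric_hahn_banach_closed_point (𝕜 := ℂ) hSconv' hSc.isClosed hb
  obtain ⟨T, c, hTc⟩ := exists_trace_pairing (f : Matrix Q Q ℂ × (κ → ι → ℂ) →ₗ[ℂ] ℂ)
  -- Both `b` and the points of `L '' S` have a first component of trace `d`, so the
  -- threshold `u` of the separation can be moved into the matrix part of the functional.
  let τ : Matrix Q Q ℂ := (u / d) • 1 - (1 / 2 : ℝ) • (T + Tᴴ)
  refine ⟨fun k i => (c k i).re, τ, fun k => ?_, ?_⟩
  · -- Scaling a positive `N` to trace `d` and placing it at position `k` gives a point of `S`.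
    have hbound : ∀ N : Matrix Q Q ℂ, N.PosSemidef →
        (T * N).trace.re + ∑ i, (c k i).re * (N * ρ i).trace.re ≤ u / d * N.trace.re := by
      intro N hN
      rcases eq_or_ne N 0 with rfl | hN0
      · simp
      have htr := hN.trace_nonneg
      have him : N.trace.im = 0 := (Complex.le_def.mp htr).2.symm
      have ht : 0 < N.trace.re := by
        refine lt_of_le_of_ne (Complex.le_def.mp htr).1 fun h => hN0 ?_
        exact hN.trace_eq_zero_iff.mp (Complex.ext h.symm him)
      have hmem : (Pi.single k ((d / N.trace.re) • N) : κ → Matrix Q Q ℂ) ∈ S := by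
        refine ⟨fun l => ?_, ?_⟩
        · rcases eq_or_ne l k with rfl | hl
          · simpa using smul_nonneg (div_pos hd ht).le (nonneg_iff_posSemidef.mpr hN)
          · simp [hl]
        · rw [Finset.sum_eq_single k (fun l _ hl => by simp [hl]) (by simp)]
          rw [Pi.single_eq_same, trace_smul]
          apply Complex.ext <;> simp [him, div_mul_cancel₀ _ ht.ne']
      have hlt := hfu _ ⟨_, hmem, rfl⟩
      have hL : L (Pi.single k ((d / N.trace.re) • N)) = ((d / N.trace.re) • N,
          Pi.single k fun i => ((d / N.trace.re) • N * ρ i).trace) := by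
        ext1
        · exact Finset.sum_pi_single' k _ _ |>.trans (by simp)
        · ext l i
          rcases eq_or_ne l k with rfl | hl
          · simp [L]
          · simp [L, hl]
      have hfT := hTc ((d / N.trace.re) • N)
        (Pi.single k fun i => ((d / N.trace.re) • N * ρ i).trace)
      rw [ContinuousLinearMap.coe_coe] at hfT
      have him' : ∀ i, (N * ρ i).trace.im = 0 := fun i =>
        hN.isHermitian.trace_mul_im (hρ i)
      have hre : RCLike.re (f (L (Pi.single k ((d / N.trace.re) • N)))) = d / N.trace.re *
          ((T * N).trace.re + ∑ i, (c k i).re * (N * ρ i).trace.re) := by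
        rw [hL, hfT, Finset.sum_eq_single k (fun l _ hl => by simp [hl]) (by simp)]
        simp [him', Finset.mul_sum, mul_add, mul_left_comm]
      rw [hre] at hlt
      have := mul_lt_mul_of_pos_left hlt (div_pos ht hd)
      rw [← mul_assoc, div_mul_div_cancel₀ hd.ne', div_self ht.ne', one_mul] at this
      exact this.le.trans_eq (by ring)
    have hτ : τ.IsHermitian := by
      refine IsHermitian.sub ?_ ?_
      · simp [IsHermitian, conjTranspose_smul]
      · simp [IsHermitian, conjTranspose_smul, add_comm]
    have hherm : (τ - ∑ i, (c k i).re • ρ i).IsHermitian := by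
      refine hτ.sub ?_
      simp [IsHermitian, conjTranspose_sum, conjTranspose_smul, (hρ _).eq]
    refine Matrix.le_iff.mpr (.of_dotProduct_mulVec_nonneg hherm fun v => ?_)
    -- Test the bound on the rank-one matrix of `v`.
    have hN := posSemidef_vecMulVec_self_star v
    have hv : star v ⬝ᵥ (τ - ∑ i, (c k i).re • ρ i) *ᵥ v =
        ((τ - ∑ i, (c k i).re • ρ i) * vecMulVec v (star v)).trace := by
      rw [mul_vecMulVec, trace_vecMulVec, dotProduct_comm]
    have hadj : (Tᴴ * vecMulVec v (star v)).trace.re = (T * vecMulVec v (star v)).trace.re := by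
      have : (Tᴴ * vecMulVec v (star v)).trace = star (T * vecMulVec v (star v)).trace := by
        rw [← trace_conjTranspose, conjTranspose_mul, hN.isHermitian.eq, trace_mul_comm]
      simp [this]
    rw [hv, Complex.le_def]
    refine ⟨?_, (hherm.trace_mul_im hN.isHermitian).symm⟩
    have hb' := hbound _ hN
    have hexp : ((τ - ∑ i, (c k i).re • ρ i) * vecMulVec v (star v)).trace.re =
        u / d * (vecMulVec v (star v)).trace.re - (T * vecMulVec v (star v)).trace.re -
          ∑ i, (c k i).re * (vecMulVec v (star v) * ρ i).trace.re := by
      simp only [τ, Matrix.sub_mul, Matrix.add_mul, Matrix.smul_mul, Matrix.sum_mul, trace_sub,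
        trace_add, trace_smul, trace_sum, Matrix.one_mul, Complex.sub_re, Complex.add_re,
        Complex.re_sum, Complex.real_smul, Complex.re_ofReal_mul, hadj,
        trace_mul_comm (vecMulVec v (star v)) (ρ _)]
      ring
    rw [hexp, Complex.zero_re]
    linarith
  · have h1 : τ.trace.re = u - T.trace.re := by
      have : u / d * d = u := div_mul_cancel₀ _ hd.ne'
      simp only [τ, trace_sub, trace_add, trace_smul, trace_one, trace_conjTranspose,
        Complex.sub_re, Complex.add_re, Complex.real_smul, Complex.re_ofReal_mul,
        Complex.star_def, Complex.conj_re, Complex.natCast_re]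
      change u / d * d - _ = _
      linarith
    have h2 : RCLike.re (f b) = T.trace.re + ∑ k, ∑ i, (c k i).re * s k i := by
      have := hTc 1 fun k i => (s k i : ℂ)
      simp only [ContinuousLinearMap.coe_coe] at this
      simp [b, this]
    linarith
end

/-! ### Bounds on the conditional min-entropy -/

/-- A classical-quantum state is bounded by `c • (1 ⊗ τ)` exactly when each of its (unnormalized)
conditional states is bounded by `c • τ`. -/
lemma cqState_le_iff {U Q : Type*} [Fintype U] [DecidableEq U] [Fintype Q]
    (p : U × Fin 2 → ℝ) (ρ : Fin 2 → Matrix Q Q ℂ) (c : ℝ) (τ : Matrix Q Q ℂ) :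
    cqState p ρ ≤ c • ((1 : Matrix U U ℂ) ⊗ₖ τ) ↔
      ∀ u, ∑ x, p (u, x) • ρ x ≤ c • τ := by
  have key : c • ((1 : Matrix U U ℂ) ⊗ₖ τ) - cqState p ρ =
      ∑ u, Matrix.single u u (1 : ℂ) ⊗ₖ (c • τ - ∑ x, p (u, x) • ρ x) := by
    ext ⟨u, q⟩ ⟨v, r⟩
    simp only [cqState, Matrix.sub_apply, Matrix.smul_apply, Matrix.sum_apply,
      kroneckerMap_apply, Matrix.single_apply, Matrix.one_apply]
    by_cases h : u = v
    · subst h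
      simp
    · have h' : ∀ w, ¬(w = u ∧ w = v) := fun w hw => h (hw.1.symm.trans hw.2)
      simp [h, h']
  rw [Matrix.le_iff, key]
  simp only [Matrix.le_iff]
  constructor
  · intro h u
    have := h.submatrix (fun q : Q => (u, q))
    convert this using 1
    ext q r
    simp [Matrix.sum_apply, Matrix.single_apply]
  · intro h
    refine Matrix.posSemidef_sum _ fun u _ => ?_
    refine PosSemidef.kronecker ?_ (h u)
    rw [← Matrix.diagonal_single]
    refine PosSemidef.diagonal ?_
    intro v
    by_cases hv : v = u <;> simp [hv]

lemma IsDensity.nonempty {Q : Type*} [Fintype Q] {ρ : Matrix Q Q ℂ} (hρ : IsDensity ρ) :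
    Nonempty Q := by
  by_contra h
  rw [not_nonempty_iff] at h
  simpa [Matrix.trace] using hρ.2

/-- The set of exponents whose supremum is the conditional min-entropy of the
classical-quantum state is nonempty: the maximally mixed state dominates, up to a factor. -/
lemma condMinEntropy_set_nonempty {U Q : Type*} [Fintype U] [DecidableEq U] [Fintype Q]
    {p : U × Fin 2 → ℝ} (hp : p ∈ stdSimplex ℝ (U × Fin 2)) {ρ : Fin 2 → Matrix Q Q ℂ}
    (hρ : ∀ i, IsDensity (ρ i)) :
    {r : ℝ | ∃ τ : Matrix Q Q ℂ, IsDensity τ ∧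
      cqState p ρ ≤ (2 : ℝ) ^ (-r) • ((1 : Matrix U U ℂ) ⊗ₖ τ)}.Nonempty := by
  classical
  have := (hρ 0).nonempty
  let d : ℝ := Fintype.card Q
  have hd : 0 < d := Nat.cast_pos.mpr Fintype.card_pos
  have h2d : 0 < 2 * d := by positivity
  refine ⟨-Real.logb 2 (2 * d), d⁻¹ • 1, ⟨?_, ?_⟩, ?_⟩
  · exact smul_nonneg (inv_nonneg.mpr hd.le) (nonneg_iff_posSemidef.mpr PosSemidef.one)
  · rw [trace_smul, trace_one]
    change (d⁻¹ : ℝ) • (Fintype.card Q : ℂ) = 1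
    rw [Complex.real_smul]
    simp [d]
  · rw [cqState_le_iff, neg_neg, Real.rpow_logb two_pos (by norm_num) h2d]
    intro u
    rw [smul_smul, mul_assoc, mul_inv_cancel₀ hd.ne', mul_one, two_smul, Fin.sum_univ_two]
    have hle : ∀ x, p (u, x) • ρ x ≤ (1 : ℝ) • (1 : Matrix Q Q ℂ) := by
      intro x
      have h1 : ρ x ≤ 1 := by
        have := (nonneg_iff_posSemidef.mp (hρ x).1).le_trace_smul_one
        rwa [(hρ x).2, Complex.one_re, one_smul] at this
      have hp1 : p (u, x) ≤ 1 := hp.2 ▸ Finset.single_le_sum (fun a _ => hp.1 a)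
        (Finset.mem_univ (u, x))
      calc p (u, x) • ρ x ≤ (1 : ℝ) • ρ x := by
            rw [← sub_nonneg, ← sub_smul]
            exact smul_nonneg (sub_nonneg.mpr hp1) (hρ x).1
        _ ≤ (1 : ℝ) • 1 := by simpa using h1
    exact add_le_add (by simpa using hle 0) (by simpa using hle 1)

/-- Weak duality: testing a dominating operator with the orthonormal basis given by the columns
of `W` bounds the guessing probability of that measurement. -/
lemma sum_le_of_cqState_le {U Q : Type*} [Fintype U] [DecidableEq U] [Fintype Q] [DecidableEq Q]
    {p : U × Fin 2 → ℝ} {W : Matrix Q U ℂ} {s : Fin 2 → U → ℝ} {σ : Fin 2 → Matrix Q Q ℂ}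
    (hW : Wᴴ * W = 1) (hW' : W * Wᴴ = 1)
    (hσ : ∀ i, σ i = W * diagonal (fun u => (s i u : ℂ)) * Wᴴ)
    {c : ℝ} {τ : Matrix Q Q ℂ} (hτ : IsDensity τ)
    (h : cqState p σ ≤ c • ((1 : Matrix U U ℂ) ⊗ₖ τ)) :
    ∑ u, ∑ i, p (u, i) * s i u ≤ c := by
  have hdiag : ∀ i u, (Wᴴ * σ i * W) u u = s i u := by
    intro i u
    have : Wᴴ * σ i * W = diagonal (fun u => (s i u : ℂ)) := by
      rw [hσ i]
      calc _ = Wᴴ * W * diagonal (fun u => (s i u : ℂ)) * (Wᴴ * W) := by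
            simp only [Matrix.mul_assoc]
        _ = _ := by simp [hW]
    simp [this]
  have hu : ∀ u, ∑ i, p (u, i) * s i u ≤ c * ((Wᴴ * τ * W) u u).re := by
    intro u
    have h1 := Matrix.mul_mul_conjTranspose_mono ((cqState_le_iff p σ c τ).mp h u) Wᴴ
    have h2 := ((Matrix.le_iff.mp h1).diag_nonneg (i := u))
    rw [Matrix.sub_apply, sub_nonneg] at h2
    have h3 := (Complex.le_def.mp h2).1
    rw [conjTranspose_conjTranspose] at h3
    simp only [Matrix.mul_sum, Matrix.sum_mul, Matrix.mul_smul, Matrix.smul_mul,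
      Matrix.sum_apply, Matrix.smul_apply, hdiag, Complex.re_sum] at h3
    simpa using h3
  calc ∑ u, ∑ i, p (u, i) * s i u ≤ ∑ u, c * ((Wᴴ * τ * W) u u).re :=
        Finset.sum_le_sum fun u _ => hu u
    _ = c * (Wᴴ * τ * W).trace.re := by
        rw [← Finset.mul_sum, Matrix.trace, Complex.re_sum]
        rfl
    _ = c := by
        rw [trace_mul_comm, ← Matrix.mul_assoc, hW', Matrix.one_mul, hτ.2]
        simp

/-- The set of exponents whose supremum is the conditional min-entropy is bounded above. -/
lemma condMinEntropy_set_bddAbove {U Q : Type*} [Fintype U] [DecidableEq U] [Fintype Q]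
    {p : U × Fin 2 → ℝ} (hp : p ∈ stdSimplex ℝ (U × Fin 2)) {ρ : Fin 2 → Matrix Q Q ℂ}
    (hρ : ∀ i, IsDensity (ρ i)) :
    BddAbove {r : ℝ | ∃ τ : Matrix Q Q ℂ, IsDensity τ ∧
      cqState p ρ ≤ (2 : ℝ) ^ (-r) • ((1 : Matrix U U ℂ) ⊗ₖ τ)} := by
  obtain ⟨a, -, ha⟩ : ∃ a ∈ Finset.univ, 0 < p a := by
    refine Finset.exists_lt_of_sum_lt (f := fun _ => (0 : ℝ)) ?_
    simp [hp.2]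
  refine ⟨-Real.logb 2 (p a), fun r ⟨τ, hτ, h⟩ => ?_⟩
  have htr := trace_re_mono ((cqState_le_iff p ρ _ τ).mp h a.1)
  have hle : p a ≤ (2 : ℝ) ^ (-r) := by
    refine le_trans (Finset.single_le_sum (f := fun x => p (a.1, x))
      (fun x _ => hp.1 (a.1, x)) (Finset.mem_univ a.2)) ?_
    simpa [trace_sum, trace_smul, (hρ _).2, hτ.2] using htr
  have := Real.logb_le_logb_of_le one_lt_two ha hle
  rw [Real.logb_rpow two_pos (by norm_num)] at this
  linarith

/-- Data processing: a channel turns every operator dominating the first classical-quantum state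
into one dominating the second. -/
theorem IsCPTP.moreInformative {Q Q' : Type*} [Fintype Q] [DecidableEq Q] [Fintype Q']
    [DecidableEq Q'] {ρ : Fin 2 → Matrix Q Q ℂ} {σ : Fin 2 → Matrix Q' Q' ℂ}
    (hρ : ∀ i, IsDensity (ρ i)) (hσ : ∀ i, IsDensity (σ i))
    {Φ : Matrix Q Q ℂ →ₗ[ℂ] Matrix Q' Q' ℂ} (hΦ : IsCPTP Φ) (hΦρ : ∀ i, Φ (ρ i) = σ i) :
    MoreInformative ρ σ := by
  intro U _ _ p hp
  refine csSup_le_csSup (condMinEntropy_set_bddAbove hp hσ) (condMinEntropy_set_nonempty hp hρ) ?_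
  rintro r ⟨τ, hτ, h⟩
  refine ⟨Φ τ, ⟨?_, (hΦ.2 τ).trans hτ.2⟩, (cqState_le_iff p σ _ _).mpr fun u => ?_⟩
  · simpa using hΦ.monotone hτ.1
  · have := hΦ.monotone ((cqState_le_iff p ρ _ τ).mp h u)
    have hr : ∀ (c : ℝ) X, Φ (c • X) = c • Φ X := fun c X => Φ.map_smul_of_tower c X
    simpa only [map_sum, hr, hΦρ] using this

/-! ### Comparison with commuting states -/

/-- If a dual certificate shows that no measurement of `ρ` reproduces the diagonal `s` of `σ`,
then, shifted to be positive and normalized, it is a joint distribution for which `σ` has the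
strictly smaller conditional min-entropy. -/
theorem not_moreInformativeOn_of_dual_certificate {U : Type} [Fintype U] [DecidableEq U]
    [Nonempty U] {Q Q' : Type*} [Fintype Q] [Fintype Q'] [DecidableEq Q']
    {ρ : Fin 2 → Matrix Q Q ℂ} {σ : Fin 2 → Matrix Q' Q' ℂ}
    (hρ : ∀ i, IsDensity (ρ i)) (hσ : ∀ i, IsDensity (σ i))
    {W : Matrix Q' U ℂ} {s : Fin 2 → U → ℝ} (hW : Wᴴ * W = 1) (hW' : W * Wᴴ = 1)
    (hσW : ∀ i, σ i = W * diagonal (fun u => (s i u : ℂ)) * Wᴴ)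
    {c : U → Fin 2 → ℝ} {τ : Matrix Q Q ℂ} (hτ : ∀ u, ∑ i, c u i • ρ i ≤ τ)
    (hlt : τ.trace.re < ∑ u, ∑ i, c u i * s i u) : ¬ MoreInformativeOn U ρ σ := by
  have hs1 : ∀ i, ∑ u, s i u = 1 := by
    intro i
    have h1 := (hσ i).2
    rw [hσW i, trace_mul_comm, ← Matrix.mul_assoc, hW, Matrix.one_mul, trace_diagonal] at h1
    exact_mod_cast h1
  -- Adding `t` to every coefficient moves both sides of `hlt` by `2 * t`.
  obtain ⟨t, ht⟩ : ∃ t : ℝ, ∀ a : U × Fin 2, 0 < c a.1 a.2 + t := by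
    refine ⟨∑ a : U × Fin 2, |c a.1 a.2| + 1, fun a => ?_⟩
    have h1 := Finset.single_le_sum (f := fun a : U × Fin 2 => |c a.1 a.2|)
      (fun a _ => abs_nonneg _) (Finset.mem_univ a)
    have h2 := neg_abs_le (c a.1 a.2)
    linarith
  let Z : ℝ := ∑ a : U × Fin 2, (c a.1 a.2 + t)
  have hZ : 0 < Z := Finset.sum_pos (fun a _ => ht a) Finset.univ_nonempty
  let p : U × Fin 2 → ℝ := fun a => Z⁻¹ * (c a.1 a.2 + t)
  have hp0 : ∀ a, 0 < p a := fun a => mul_pos (inv_pos.mpr hZ) (ht a)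
  have hp : p ∈ stdSimplex ℝ (U × Fin 2) := by
    refine ⟨fun a => (hp0 a).le, ?_⟩
    rw [← Finset.mul_sum]
    exact inv_mul_cancel₀ hZ.ne'
  let τ' : Matrix Q Q ℂ := Z⁻¹ • (τ + t • ∑ i, ρ i)
  have hτ' : ∀ u, ∑ i, p (u, i) • ρ i ≤ τ' := by
    intro u
    have : ∑ i, p (u, i) • ρ i = Z⁻¹ • (∑ i, c u i • ρ i + t • ∑ i, ρ i) := by
      simp only [p, mul_smul, ← Finset.smul_sum, add_smul, Finset.sum_add_distrib]
    rw [this]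
    exact smul_le_smul_of_nonneg_left (add_le_add_left (hτ u) _) (inv_pos.mpr hZ).le
  have hlt' : τ'.trace.re < ∑ u, ∑ i, p (u, i) * s i u := by
    have h1 : τ'.trace.re = Z⁻¹ * (τ.trace.re + 2 * t) := by
      simp [τ', trace_smul, trace_add, (hρ _).2]
      ring
    have h2 : ∑ u, ∑ i, p (u, i) * s i u = Z⁻¹ * (∑ u, ∑ i, c u i * s i u + 2 * t) := by
      have h3 : ∑ u, ∑ i, t * s i u = 2 * t := by
        rw [Finset.sum_comm]
        simp [← Finset.mul_sum, hs1, mul_comm]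
      rw [← h3]
      simp only [p, mul_assoc, ← Finset.mul_sum, add_mul, Finset.sum_add_distrib]
    rw [h1, h2]
    gcongr
  have hτ'0 : 0 ≤ τ' := le_trans (Finset.sum_nonneg fun i _ =>
    smul_nonneg (hp0 _).le (hρ i).1) (hτ' (Classical.arbitrary U))
  have hpos : 0 < τ'.trace.re := by
    refine lt_of_lt_of_le ?_ (trace_re_mono (hτ' (Classical.arbitrary U)))
    have h0 := hp0 (Classical.arbitrary U, 0)
    have h1 := hp0 (Classical.arbitrary U, 1)
    simp [trace_add, trace_smul, (hρ _).2]
    linarith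
  have him : τ'.trace = (τ'.trace.re : ℂ) := by
    refine Complex.ext rfl ?_
    simpa using (Complex.le_def.mp (nonneg_iff_posSemidef.mp hτ'0).trace_nonneg).2.symm
  intro hmore
  -- Normalizing `τ'` gives a lower bound for the entropy of `ρ`.
  have hlow : -Real.logb 2 τ'.trace.re ≤ condMinEntropy (cqState p ρ) := by
    refine le_csSup (condMinEntropy_set_bddAbove hp hρ)
      ⟨τ'.trace.re⁻¹ • τ', ⟨smul_nonneg (inv_pos.mpr hpos).le hτ'0, ?_⟩, ?_⟩
    · rw [trace_smul, him, Complex.real_smul, Complex.ofReal_re, ← Complex.ofReal_mul,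
        inv_mul_cancel₀ hpos.ne', Complex.ofReal_one]
    · rw [cqState_le_iff, neg_neg, Real.rpow_logb two_pos (by norm_num) hpos, smul_smul,
        mul_inv_cancel₀ hpos.ne', one_smul]
      exact hτ'
  -- Guessing with the eigenbasis of `σ` gives an upper bound for the entropy of `σ`.
  have hup : condMinEntropy (cqState p σ) ≤
      -Real.logb 2 (∑ u, ∑ i, p (u, i) * s i u) := by
    refine csSup_le (condMinEntropy_set_nonempty hp hσ) fun r ⟨ω, hω, h⟩ => ?_
    have hle := sum_le_of_cqState_le hW hW' hσW hω h
    have := Real.logb_le_logb_of_le one_lt_two (hpos.trans hlt') hle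
    rw [Real.logb_rpow two_pos (by norm_num)] at this
    linarith
  have := Real.logb_lt_logb one_lt_two hpos hlt'
  linarith [hmore p hp]

theorem lemma2 {Q Q' : Type*} [Fintype Q] [DecidableEq Q] [Fintype Q'] [DecidableEq Q']
    (ρ : Fin 2 → Matrix Q Q ℂ) (σ : Fin 2 → Matrix Q' Q' ℂ)
    (hρ : ∀ i, IsDensity (ρ i)) (hσ : ∀ i, IsDensity (σ i))
    (hcomm : Commute (σ 0) (σ 1)) :
    (MoreInformative ρ σ ↔
      ∃ Φ : Matrix Q Q ℂ →ₗ[ℂ] Matrix Q' Q' ℂ, IsCPTP Φ ∧ ∀ i, Φ (ρ i) = σ i) ∧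
    (MoreInformative ρ σ ↔
      ∀ (U : Type) [Fintype U] [DecidableEq U],
        Fintype.card U = Fintype.card Q' → MoreInformativeOn U ρ σ) := by
  have hchannel : (∃ Φ : Matrix Q Q ℂ →ₗ[ℂ] Matrix Q' Q' ℂ, IsCPTP Φ ∧ ∀ i, Φ (ρ i) = σ i) →
      MoreInformative ρ σ := fun ⟨_, hΦ, hΦρ⟩ => hΦ.moreInformative hρ hσ hΦρ
  suffices hmain : (∀ (U : Type) [Fintype U] [DecidableEq U],
      Fintype.card U = Fintype.card Q' → MoreInformativeOn U ρ σ) →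
        ∃ Φ : Matrix Q Q ℂ →ₗ[ℂ] Matrix Q' Q' ℂ, IsCPTP Φ ∧ ∀ i, Φ (ρ i) = σ i from
    ⟨⟨fun h => hmain fun U _ _ _ => h U, hchannel⟩,
      ⟨fun h U _ _ _ => h U, fun h => hchannel (hmain h)⟩⟩
  intro h
  have hQ := (hρ 0).nonempty
  have hQ' := (hσ 0).nonempty
  have : Nonempty (Fin (Fintype.card Q')) := Fin.pos_iff_nonempty.mp Fintype.card_pos
  obtain ⟨W, s, hW, hW', hσW⟩ := IsHermitian.exists_simultaneous_diagonalization
    (fun i => (nonneg_iff_posSemidef.mp (hσ i).1).isHermitian) hcomm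
  rcases exists_measurement_or_dual_certificate
      (fun i => (nonneg_iff_posSemidef.mp (hρ i).1).isHermitian) (fun k i => s i k) with
    ⟨M, hM, hsum, hMs⟩ | ⟨c, τ, hτ, hlt⟩
  · refine ⟨measurePrepare M W, isCPTP_measurePrepare hM hsum hW, fun i => ?_⟩
    simp only [measurePrepare_apply, hMs, hσW i]
  · exact absurd (h (Fin (Fintype.card Q')) (Fintype.card_fin _))
      (not_moreInformativeOn_of_dual_certificate hρ hσ hW hW' hσW hτ hlt)
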